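/- Let $\mathcal H$ be a separable complex Hilbert space with inner product anti-linear in the first argument, $A$ a possibly unbounded self-adjoint operator in $\mathcal H$ with discrete spectrum of multiplicity one (every point of $\mathrm{Sp}(A)$ is isolated and is an eigenvalue of multiplicity one), and $\mu\in\mathcal H$ a cyclic vector for $A$ (the set $\{(A-zI)^{-1}\mu : z\in\mathbb C\setminus\mathrm{Sp}(A)\}$ is total) with $\|\mu\|=1$. For $h\in\mathbb R$ put $A_h:=A+h\langle\mu,\cdot\rangle\mu$ on $\mathrm{dom}(A)$, and let $A_\infty$ be the operator in $\{\mu\}^\perp$ with domain $\{\varphi\in\mathrm{dom}(A):\langle\varphi,\mu\rangle=0\}$ that maps $\varphi$ to the orthogonal projection of $A\varphi$ on $\{\mu\}^\perp$. Let $F(z):=\langle\mu,(A-zI)^{-1}\mu\rangle$ and $$\xi(z):=\frac{(A-\overline zI)^{-1}\mu}{F(\overline z)},\qquad z\in\mathbb C\setminus\mathrm{Sp}(A_\infty),$$ extended by continuity to the points of $\mathrm{Sp}(A)$, and for $\varphi\in\mathcal H$ let $$(\Phi_\mu\varphi)(z):=\langle\xi(z),\varphi\rangle,\qquad z\in\mathbb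 C\setminus\mathrm{Sp}(A_\infty).$$ For $h\in\mathbb R$ let $m_h(t):=\langle\mu,E_h(t)\mu\rangle$ be the spectral function of $A_h$ at $\mu$, where $E_h(t)$, the spectral resolution of the identity of $A_h$, is the orthogonal projection on the closed span of the eigenvectors of $A_h$ with eigenvalue at most $t$; write $m_h$ also for the corresponding Lebesgue–Stieltjes measure on $\mathbb R$. Then for every $h\in\mathbb R$ the measure $m_h$ is discrete, namely $$m_h=\sum_{x_j\in\mathrm{Sp}(A_h)}\|\xi(x_j)\|^{-2}\,\delta_{x_j},$$ and $\Phi_\mu$ is a unitary transformation from $\mathcal H$ onto $L^2(\mathbb R,dm_h)$: $m_h$-almost every $x\in\mathbb R$ lies outside $\mathrm{Sp}(A_\infty)$, and the map sending $\varphi$ to the class of $x\mapsto(\Phi_\mu\varphi)(x)$ is a linear isometry of $\mathcal H$ onto $L^2(\mathbb R,dm_h)$. -/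

import Mathlib

noncomputable section

namespace RankOne

variable {H : Type*} [NormedAddCommGroup H] [InnerProductSpace ℂ H]

/-- `R` is the bounded everywhere defined inverse of `T - z`. -/
def IsResolventAt (T : H →ₗ.[ℂ] H) (z : ℂ) (R : H →L[ℂ] H) : Prop :=
  (∀ ψ : H, ∃ hψ : R ψ ∈ T.domain, T ⟨R ψ, hψ⟩ - z • R ψ = ψ) ∧
    ∀ φ : T.domain, R (T φ - z • (φ : H)) = φ

/-- The spectrum `Sp(T)` of a possibly unbounded operator: the complement of the set of those `z`
for which `T - z` has a bounded everywhere defined inverse. -/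
def spec (T : H →ₗ.[ℂ] H) : Set ℂ :=
  {z | ¬ ∃ R : H →L[ℂ] H, IsResolventAt T z R}

open Classical in
/-- The resolvent `(T - z)⁻¹` for `z ∉ Sp(T)` (and `0` for `z ∈ Sp(T)`). -/
def resolv (T : H →ₗ.[ℂ] H) (z : ℂ) : H →L[ℂ] H :=
  if hz : ∃ R : H →L[ℂ] H, IsResolventAt T z R then hz.choose else 0

/-- The kernel of `T - z`. -/
def eigenspace (T : H →ₗ.[ℂ] H) (z : ℂ) : Submodule ℂ H where
  carrier := {φ | ∃ hφ : φ ∈ T.domain, T ⟨φ, hφ⟩ = z • φ}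
  add_mem' := by
    rintro a b ⟨ha, ha'⟩ ⟨hb, hb'⟩
    refine ⟨T.domain.add_mem ha hb, ?_⟩
    have := T.map_add ⟨a, ha⟩ ⟨b, hb⟩
    rw [ha', hb', ← smul_add] at this
    exact this
  zero_mem' := ⟨T.domain.zero_mem, by rw [smul_zero]; exact T.map_zero⟩
  smul_mem' := by
    rintro c a ⟨ha, ha'⟩
    refine ⟨T.domain.smul_mem c ha, ?_⟩
    have := T.map_smul c ⟨a, ha⟩
    rw [ha', smul_comm] at this
    exact this

/-- Discrete spectrum of multiplicity one: every point of the spectrum is isolated in the spectrum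
and is an eigenvalue of multiplicity one. -/
structure HasSimpleDiscreteSpectrum (T : H →ₗ.[ℂ] H) : Prop where
  isolated : ∀ z ∈ spec T, ∀ᶠ w in nhdsWithin z {z}ᶜ, w ∉ spec T
  simple : ∀ z ∈ spec T, Module.finrank ℂ (eigenspace T z) = 1

/-- `μ` is a cyclic vector: the vectors `(T - z)⁻¹ μ`, `z ∉ Sp(T)`, form a total set. -/
def IsCyclicVector (T : H →ₗ.[ℂ] H) (μ : H) : Prop :=
  Dense (Submodule.span ℂ ((fun z => resolv T z μ) '' (spec T)ᶜ) : Set H)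

/-- The bounded rank-one perturbation `A_h = A + h ⟨μ, ·⟩ μ`, with domain that of `A`. -/
def perturb (A : H →ₗ.[ℂ] H) (μ : H) (h : ℝ) : H →ₗ.[ℂ] H where
  domain := A.domain
  toFun := A.toFun + (h : ℂ) • ((innerSL ℂ μ).toLinearMap.smulRight μ).comp A.domain.subtype

theorem perturb_apply (A : H →ₗ.[ℂ] H) (μ : H) (h : ℝ) (φ : A.domain) :
    perturb A μ h φ = A φ + (h : ℂ) • inner ℂ μ (φ : H) • μ := rfl

/-- The operator `A_∞` of infinite coupling: the self-adjoint operator in the Hilbert space `{μ}ᗮ`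
with domain `{φ ∈ dom A : ⟨φ, μ⟩ = 0}` that sends `φ` to the orthogonal projection of `A φ`
on `{μ}ᗮ`. -/
def perturbInfty (A : H →ₗ.[ℂ] H) (μ : H) : (ℂ ∙ μ)ᗮ →ₗ.[ℂ] (ℂ ∙ μ)ᗮ where
  domain := A.domain.comap (ℂ ∙ μ)ᗮ.subtype
  toFun := (ℂ ∙ μ)ᗮ.orthogonalProjectionOnto.toLinearMap ∘ₗ A.toFun ∘ₗ
    ((ℂ ∙ μ)ᗮ.subtype.restrict (fun _ hφ => hφ))

theorem perturbInfty_apply (A : H →ₗ.[ℂ] H) (μ : H) (φ : (perturbInfty A μ).domain) :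
    perturbInfty A μ φ = (ℂ ∙ μ)ᗮ.orthogonalProjectionOnto (A ⟨((φ : (ℂ ∙ μ)ᗮ) : H), φ.2⟩) := rfl

/-- The function `F(z) = ⟨μ, (A - z)⁻¹ μ⟩`, `z ∉ Sp(A)`. -/
def weyl (A : H →ₗ.[ℂ] H) (μ : H) (z : ℂ) : ℂ := inner ℂ μ (resolv A z μ)

open Classical in
/-- The vector-valued function `ξ(z) = (A - z̄)⁻¹ μ / F(z̄)`, `z ∉ Sp(A_∞)`. At the points of
`Sp(A)`, which are removable singularities of the right-hand side, it is extended by continuity. -/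
def xi (A : H →ₗ.[ℂ] H) (μ : H) (z : ℂ) : H :=
  if star z ∈ spec A then
    Filter.limUnder (nhdsWithin z {z}ᶜ) fun w => (weyl A μ (star w))⁻¹ • resolv A (star w) μ
  else (weyl A μ (star z))⁻¹ • resolv A (star z) μ

/-- The map `Φ_μ`, which sends `φ` to the function `z ↦ ⟨ξ(z), φ⟩` on `ℂ ∖ Sp(A_∞)`. -/
def Phi (A : H →ₗ.[ℂ] H) (μ φ : H) (z : {z : ℂ // z ∉ spec (perturbInfty A μ)}) : ℂ :=
  inner ℂ (xi A μ z) φ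

/-- The closed linear span of the eigenvectors of `T` with real eigenvalue at most `t`. -/
def spectralSubspace (T : H →ₗ.[ℂ] H) (t : ℝ) : Submodule ℂ H :=
  (⨆ x : Set.Iic t, eigenspace T ((x : ℝ) : ℂ)).topologicalClosure

theorem spectralSubspace_mono (T : H →ₗ.[ℂ] H) : Monotone (spectralSubspace T) := by
  intro s t hst
  refine Submodule.topologicalClosure_mono (iSup_le fun x => ?_)
  exact le_iSup (fun y : Set.Iic t => eigenspace T ((y : ℝ) : ℂ)) ⟨x, le_trans x.2 hst⟩

section SpectralFunction

variable [CompleteSpace H]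

instance (T : H →ₗ.[ℂ] H) (t : ℝ) : CompleteSpace (spectralSubspace T t) :=
  inferInstanceAs (CompleteSpace (Submodule.topologicalClosure _))

/-- The spectral resolution of the identity `E(t)` of a self-adjoint operator with discrete
spectrum: the orthogonal projection on the closed span of the eigenvectors whose eigenvalue is at
most `t`. -/
def spectralResolution (T : H →ₗ.[ℂ] H) (t : ℝ) : H →L[ℂ] H :=
  (spectralSubspace T t).starProjection

/-- The spectral function `t ↦ ⟨μ, E(t) μ⟩` of `T` at `μ`. -/
def spectralFunction (T : H →ₗ.[ℂ] H) (μ : H) (t : ℝ) : ℝ :=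
  (inner ℂ μ (spectralResolution T t μ)).re

theorem spectralFunction_mono (T : H →ₗ.[ℂ] H) (μ : H) : Monotone (spectralFunction T μ) := by
  have key : ∀ t, spectralFunction T μ t = ‖(spectralSubspace T t).starProjection μ‖ ^ 2 := by
    intro t
    have h := Submodule.inner_starProjection_left_eq_right (spectralSubspace T t) μ
      ((spectralSubspace T t).starProjection μ)
    rw [Submodule.starProjection_eq_self_iff.mpr (Submodule.starProjection_apply_mem _ _)] at h
    unfold spectralFunction spectralResolution
    rw [← h, inner_self_eq_norm_sq_to_K]
    norm_cast
  intro s t hst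
  rw [key, key]
  have hc : (spectralSubspace T s).starProjection μ =
      (spectralSubspace T s).starProjection ((spectralSubspace T t).starProjection μ) := by
    have := Submodule.starProjection_comp_starProjection_of_le (spectralSubspace_mono T hst)
    exact (DFunLike.congr_fun this μ).symm
  rw [hc]
  gcongr
  exact Submodule.norm_starProjection_apply_le _ _

/-- The Lebesgue–Stieltjes measure on the real line of the spectral function of `T` at `μ`. -/
def spectralMeasure (T : H →ₗ.[ℂ] H) (μ : H) : MeasureTheory.Measure ℝ :=
  (spectralFunction_mono T μ).stieltjesFunction.measure

end SpectralFunction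

end RankOne

end

namespace RankOne

/-! ### Graphs, symmetry and rank-one perturbation of resolvents -/

section Graph

variable {H : Type*} [NormedAddCommGroup H] [InnerProductSpace ℂ H]

/-! Everything reduces to compact resolvents. By separability a symmetric operator has countably
many eigenvalues, so some real `x` is regular for `A`. The nonzero spectrum of the self-adjoint
resolvent at `x` comes from `Sp(A)`, hence consists of isolated eigenvalues with one-dimensional
eigenspaces, and the resolvent is compact (`isCompactOperator_resolvent`). A rank-one correction
keeps it compact, so each `A_h` has an orthogonal eigenbasis and its spectrum is its set of
eigenvalues.

An eigenvector of `A_h` orthogonal to `μ` would be an eigenvector of `A` orthogonal to all `(A -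
w)⁻¹ μ`, against cyclicity. So each eigenspace is spanned by a unique `e` with `⟨μ, e⟩ = 1`. The
crux is that `ξ(x) = e` (`xi_eq_of_mem_eigenspace`): off `Sp(A)`, `(A - x) e = -h μ` gives `e = -h
(A - x)⁻¹ μ`, and pairing with `μ` gives `-h F(x) = 1`; on `Sp(A)` necessarily `h = 0` and the limit
defining `ξ` is computed.

Thus the vectors `ξ(x) / ‖ξ(x)‖` form a Hilbert basis in which `μ` has coefficients `‖ξ(x)‖⁻¹`. This
gives the weights of `m_h`, and `Φ_μ` is the expansion in this basis, rescaled by the weights. -/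

theorem isResolventAt_iff_graph {T : H →ₗ.[ℂ] H} {z : ℂ} {R : H →L[ℂ] H} :
    IsResolventAt T z R ↔ (∀ ψ, (R ψ, ψ + z • R ψ) ∈ T.graph) ∧
      ∀ φ χ, (φ, χ) ∈ T.graph → R (χ - z • φ) = φ := by
  unfold IsResolventAt
  refine and_congr (forall_congr' fun ψ => ?_) ⟨fun h φ χ hφ => ?_, fun h φ => ?_⟩
  · rw [LinearPMap.mem_graph_iff]
    constructor
    · rintro ⟨h, h'⟩
      exact ⟨⟨R ψ, h⟩, rfl, eq_add_of_sub_eq h'⟩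
    · rintro ⟨⟨y, hy⟩, h, h'⟩
      simp only at h h'
      subst h
      exact ⟨hy, by rw [h', add_sub_cancel_right]⟩
  · rw [LinearPMap.mem_graph_iff] at hφ
    obtain ⟨y, h1, h2⟩ := hφ
    simp only at h1 h2
    rw [← h1, ← h2]
    exact h y
  · exact h _ _ (T.mem_graph φ)

theorem mem_eigenspace_iff_graph {T : H →ₗ.[ℂ] H} {z : ℂ} {φ : H} :
    φ ∈ eigenspace T z ↔ (φ, z • φ) ∈ T.graph := by
  rw [LinearPMap.mem_graph_iff]
  constructor
  · rintro ⟨h, h'⟩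
    exact ⟨⟨φ, h⟩, rfl, h'⟩
  · rintro ⟨⟨y, hy⟩, h, h'⟩
    simp only at h h'
    subst h
    exact ⟨hy, h'⟩

theorem mem_graph_perturb {T : H →ₗ.[ℂ] H} {μ : H} {h : ℝ} {φ χ : H} :
    (φ, χ) ∈ (perturb T μ h).graph ↔ (φ, χ - (h : ℂ) • inner ℂ μ φ • μ) ∈ T.graph := by
  rw [LinearPMap.mem_graph_iff, LinearPMap.mem_graph_iff]
  constructor
  · rintro ⟨y, rfl, h'⟩
    refine ⟨y, rfl, ?_⟩
    simp only at h' ⊢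
    rw [← h']
    exact (eq_sub_of_add_eq rfl)
  · rintro ⟨y, rfl, h'⟩
    refine ⟨y, rfl, ?_⟩
    rw [perturb_apply]
    simp only at h' ⊢
    rw [h', sub_add_cancel]

/-- Symmetry of a partially defined operator, in terms of its graph. -/
def IsSymm (T : H →ₗ.[ℂ] H) : Prop :=
  ∀ φ χ φ' χ' : H, (φ, χ) ∈ T.graph → (φ', χ') ∈ T.graph → inner ℂ χ φ' = inner ℂ φ χ'

theorem isSymm_of_isSelfAdjoint [CompleteSpace H] {T : H →ₗ.[ℂ] H} (hT : IsSelfAdjoint T) :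
    IsSymm T := by
  intro φ χ φ' χ' h h'
  rw [LinearPMap.mem_graph_iff] at h h'
  obtain ⟨y, rfl, rfl⟩ := h
  obtain ⟨y', rfl, rfl⟩ := h'
  have key := LinearPMap.adjoint_isFormalAdjoint (T := T) hT.dense_domain
  rw [LinearPMap.isSelfAdjoint_def.mp hT] at key
  exact key y y'

theorem IsSymm.perturb {T : H →ₗ.[ℂ] H} (hT : IsSymm T) (μ : H) (h : ℝ) :
    IsSymm (perturb T μ h) := by
  intro φ χ φ' χ' h1 h2
  rw [mem_graph_perturb] at h1 h2
  have := hT _ _ _ _ h1 h2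
  simp only [inner_sub_left, inner_sub_right, inner_smul_left, inner_smul_right,
    Complex.conj_ofReal, inner_conj_symm] at this
  linear_combination this

theorem IsSymm.eigenvalue_real {T : H →ₗ.[ℂ] H} (hT : IsSymm T) {z : ℂ} {φ : H}
    (hφ : φ ∈ eigenspace T z) (h0 : φ ≠ 0) : ((z.re : ℝ) : ℂ) = z := by
  rw [mem_eigenspace_iff_graph] at hφ
  have := hT _ _ _ _ hφ hφ
  rw [inner_smul_left, inner_smul_right] at this
  exact Complex.conj_eq_iff_re.mp (mul_right_cancel₀ (inner_self_ne_zero.mpr h0) this)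

theorem IsSymm.inner_eq_zero {T : H →ₗ.[ℂ] H} (hT : IsSymm T) {x y : ℝ} (hxy : x ≠ y) {φ ψ : H}
    (hφ : φ ∈ eigenspace T x) (hψ : ψ ∈ eigenspace T y) : inner ℂ φ ψ = 0 := by
  rw [mem_eigenspace_iff_graph] at hφ hψ
  have := hT _ _ _ _ hφ hψ
  rw [inner_smul_left, inner_smul_right, Complex.conj_ofReal] at this
  have h2 : ((x : ℂ) - y) * inner ℂ φ ψ = 0 := by linear_combination this
  refine (mul_eq_zero.mp h2).resolve_left ?_
  exact fun h0 => hxy (by exact_mod_cast sub_eq_zero.mp h0)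

/-- Unit eigenvectors for distinct eigenvalues are at distance `√2`, so the balls of radius `1/2`
around them are disjoint, and a separable space holds only countably many. -/
theorem IsSymm.countable_eigenvalues [TopologicalSpace.SeparableSpace H] {T : H →ₗ.[ℂ] H}
    (hT : IsSymm T) : {x : ℝ | eigenspace T x ≠ ⊥}.Countable := by
  have hex : ∀ x : {x : ℝ | eigenspace T x ≠ ⊥}, ∃ e : H, e ∈ eigenspace T (x : ℝ) ∧ ‖e‖ = 1 := by
    rintro ⟨x, hx⟩
    obtain ⟨v, hv, hv0⟩ := Submodule.exists_mem_ne_zero_of_ne_bot hx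
    refine ⟨((‖v‖⁻¹ : ℝ) : ℂ) • v, Submodule.smul_mem _ _ hv, ?_⟩
    rw [norm_smul, Complex.norm_real, norm_inv, norm_norm,
      inv_mul_cancel₀ (norm_ne_zero_iff.mpr hv0)]
  choose e he hn using hex
  have : Countable {x : ℝ | eigenspace T x ≠ ⊥} := by
    refine Pairwise.countable_of_isOpen_disjoint (s := fun x => Metric.ball (e x) (1 / 2)) ?_
      (fun _ => Metric.isOpen_ball) (fun x => ⟨e x, Metric.mem_ball_self (by norm_num)⟩)
    intro x y hxy
    refine Metric.ball_disjoint_ball ?_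
    have h0 : inner ℂ (e x) (e y) = 0 :=
      hT.inner_eq_zero (fun h => hxy (Subtype.ext h)) (he x) (he y)
    have h1 := norm_sub_sq (𝕜 := ℂ) (e x) (e y)
    rw [h0, hn, hn] at h1
    rw [dist_eq_norm]
    simp at h1
    nlinarith [norm_nonneg (e x - e y)]
  exact this.to_set

theorem IsSymm.resolvent_inner {T : H →ₗ.[ℂ] H} (hT : IsSymm T) {x : ℝ} {R : H →L[ℂ] H}
    (hR : IsResolventAt T x R) (φ ψ : H) : inner ℂ (R φ) ψ = inner ℂ φ (R ψ) := by
  rw [isResolventAt_iff_graph] at hR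
  have := hT _ _ _ _ (hR.1 φ) (hR.1 ψ)
  simp only [inner_add_left, inner_add_right, inner_smul_left, inner_smul_right,
    Complex.conj_ofReal] at this
  linear_combination -this

theorem IsResolventAt.eigenspace_eq_bot {T : H →ₗ.[ℂ] H} {z : ℂ} {R : H →L[ℂ] H}
    (hR : IsResolventAt T z R) : eigenspace T z = ⊥ := by
  rw [isResolventAt_iff_graph] at hR
  rw [eq_bot_iff]
  intro φ hφ
  rw [mem_eigenspace_iff_graph] at hφ
  have := hR.2 _ _ hφ
  rw [sub_self, map_zero] at this
  exact this.symm

theorem IsResolventAt.mem_eigenspace_of_resolvent {T : H →ₗ.[ℂ] H} {z c : ℂ} {R : H →L[ℂ] H}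
    (hR : IsResolventAt T z R) (hc : c ≠ 0) {φ : H} (hφ : R φ = c • φ) :
    φ ∈ eigenspace T (z + c⁻¹) := by
  rw [isResolventAt_iff_graph] at hR
  have h := T.graph.smul_mem c⁻¹ (hR.1 φ)
  rw [mem_eigenspace_iff_graph]
  convert h using 1
  rw [hφ]
  ext
  · simp [smul_smul, hc]
  · simp only [Prod.smul_mk]
    rw [smul_add, smul_comm z c, smul_smul c⁻¹ c, inv_mul_cancel₀ hc, one_smul, add_smul, add_comm]

theorem isResolventAt_resolv {T : H →ₗ.[ℂ] H} {z : ℂ} (hz : z ∉ spec T) :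
    IsResolventAt T z (resolv T z) := by
  unfold spec at hz
  simp only [Set.mem_ofPred_eq, not_not] at hz
  unfold resolv
  rw [dif_pos hz]
  exact hz.choose_spec

theorem IsResolventAt.notMem_spec {T : H →ₗ.[ℂ] H} {z : ℂ} {R : H →L[ℂ] H}
    (hR : IsResolventAt T z R) : z ∉ spec T := fun h => h ⟨R, hR⟩

/-- Sherman–Morrison: `R' = R - h (1 + h F)⁻¹ ⟨R μ, ·⟩ R μ` with `F = ⟨μ, R μ⟩`, where `R` is
symmetric because `x` is real. If `1 + h F` vanished, `R μ` would be an eigenvector of the perturbed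
operator. -/
theorem resolvent_perturb {T : H →ₗ.[ℂ] H} (hT : IsSymm T) {x : ℝ} {R : H →L[ℂ] H}
    (hR : IsResolventAt T x R) (hc : IsCompactOperator R) {μ : H} {h : ℝ}
    (hx : eigenspace (perturb T μ h) x = ⊥) :
    ∃ R' : H →L[ℂ] H, IsResolventAt (perturb T μ h) x R' ∧ IsCompactOperator R' := by
  have hsymm := hT.resolvent_inner hR
  rw [isResolventAt_iff_graph] at hR
  have hne : 1 + h * inner ℂ μ (R μ) ≠ 0 := by
    intro h0
    have hmem : R μ ∈ eigenspace (perturb T μ h) x := by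
      rw [mem_eigenspace_iff_graph, mem_graph_perturb]
      convert hR.1 μ using 2
      rw [smul_smul, eq_neg_of_add_eq_zero_right h0]
      module
    rw [hx, Submodule.mem_bot] at hmem
    rw [hmem, inner_zero_right] at h0
    simp at h0
  set F := inner ℂ μ (R μ) with hF
  set k : ℂ := h / (1 + h * F) with hk
  have hk' : k * (1 + h * F) = h := div_mul_cancel₀ _ hne
  refine ⟨R - k • (innerSL ℂ (R μ)).smulRight (R μ), ?_, ?_⟩
  · rw [isResolventAt_iff_graph]
    constructor
    · intro ψ
      rw [mem_graph_perturb]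
      convert T.graph.sub_mem (hR.1 ψ) (T.graph.smul_mem (k * inner ℂ (R μ) ψ) (hR.1 μ)) using 1
      refine Prod.ext ?_ ?_
      · simp [smul_smul]
      · have e : h * (inner ℂ μ (R ψ) - k * (inner ℂ (R μ) ψ * F)) = k * inner ℂ (R μ) ψ := by
          rw [← hsymm]
          linear_combination (-inner ℂ (R μ) ψ) * hk'
        simp only [Prod.smul_mk, Prod.mk_sub_mk, sub_apply,
          smul_apply, ContinuousLinearMap.smulRight_apply, innerSL_apply_apply,
          inner_sub_right, inner_smul_right, ← hF]
        rw [smul_smul (h : ℂ), e]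
        module
    · intro φ χ hφ
      rw [mem_graph_perturb] at hφ
      have e1 := hR.2 _ _ hφ
      have e2 : R (χ - (x : ℂ) • φ) = φ + (h * inner ℂ μ φ) • R μ := by
        have : χ - (x : ℂ) • φ = (χ - (h : ℂ) • inner ℂ μ φ • μ - (x : ℂ) • φ)
          + (h * inner ℂ μ φ) • μ := by module
        rw [this, map_add, e1, map_smul]
      have e3 : inner ℂ (R μ) (χ - (x : ℂ) • φ) = (1 + h * F) * inner ℂ μ φ := by
        rw [hsymm, e2, inner_add_right, inner_smul_right]
        ring
      simp only [sub_apply,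
          smul_apply, ContinuousLinearMap.smulRight_apply, innerSL_apply_apply,
          e2, e3, smul_smul]
      rw [← mul_assoc, hk']
      module
  · refine hc.sub ?_
    refine IsCompactOperator.smul ?_ k
    exact (isCompactOperator_of_locallyCompactSpace_rng
      (ContinuousLinearMap.toSpanSingleton ℂ (R μ))).comp_clm (innerSL ℂ (R μ))

end Graph

/-! ### Symmetric operators with compact resolvent -/

section CompactResolvent

variable {H : Type*} [NormedAddCommGroup H] [InnerProductSpace ℂ H]

/-- A symmetric operator with a compact resolvent at some point of the real line. -/
structure HasCompactResolvent (T : H →ₗ.[ℂ] H) : Prop where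
  symm : IsSymm T
  exists_resolvent : ∃ (x : ℝ) (R : H →L[ℂ] H), IsResolventAt T x R ∧ IsCompactOperator R

variable [CompleteSpace H]

/-- The Fredholm alternative for operators with compact resolvent. -/
theorem HasCompactResolvent.exists_resolvent_of_eigenspace_eq_bot {T : H →ₗ.[ℂ] H}
    (hT : HasCompactResolvent T) {z : ℂ} (hz : eigenspace T z = ⊥) :
    ∃ R : H →L[ℂ] H, IsResolventAt T z R ∧ IsCompactOperator R := by
  obtain ⟨x, R, hR, hc⟩ := hT.exists_resolvent
  by_cases hzx : z = x
  · exact ⟨R, hzx ▸ hR, hc⟩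
  have hd : z - x ≠ 0 := sub_ne_zero.mpr hzx
  have hinv : (z - x)⁻¹ ≠ 0 := inv_ne_zero hd
  have hres : (z - x)⁻¹ ∈ resolventSet ℂ R := by
    refine (IsCompactOperator.hasEigenvalue_or_mem_resolventSet hc hinv).resolve_left fun h => ?_
    obtain ⟨v, hv, hv0⟩ := h.exists_hasEigenvector
    rw [Module.End.mem_eigenspace_iff] at hv
    have := hR.mem_eigenspace_of_resolvent hinv hv
    rw [inv_inv, add_sub_cancel, hz] at this
    exact hv0 this
  obtain ⟨u, hu⟩ := spectrum.mem_resolventSet_iff.mp hres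
  set V : H →L[ℂ] H := ↑u⁻¹ with hV
  have h1 : ∀ φ, (z - x)⁻¹ • V φ - R (V φ) = φ := by
    intro φ
    have := congrArg (fun f : H →L[ℂ] H => f φ) u.mul_inv
    rw [hu] at this
    simpa [Algebra.algebraMap_eq_smul_one] using this
  have h2 : ∀ φ, V ((z - x)⁻¹ • φ - R φ) = φ := by
    intro φ
    have := congrArg (fun f : H →L[ℂ] H => f φ) u.inv_mul
    rw [hu] at this
    simpa [Algebra.algebraMap_eq_smul_one] using this
  -- This is `R (1 - (z - x) R)⁻¹`, the first resolvent identity solved for the resolvent at `z`.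
  refine ⟨(z - x)⁻¹ • (R ∘L V), ?_, ?_⟩
  · rw [isResolventAt_iff_graph] at hR ⊢
    constructor
    · intro ψ
      have h := T.graph.smul_mem (z - x)⁻¹ (hR.1 (V ψ))
      convert h using 1
      refine Prod.ext rfl ?_
      simp only [Prod.smul_mk, smul_apply, ContinuousLinearMap.comp_apply]
      nth_rw 1 [← h1 ψ]
      have : R (V ψ) = (z - x) • (z - x)⁻¹ • R (V ψ) := by rw [smul_inv_smul₀ hd]
      nth_rw 1 [this]
      module
    · intro φ χ hφ
      have hφ' := hR.2 _ _ hφ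
      have e1 : χ - z • φ = (z - x) • ((z - x)⁻¹ • (χ - (x : ℂ) • φ) - R (χ - (x : ℂ) • φ)) := by
        rw [hφ', smul_sub, smul_inv_smul₀ hd]
        module
      rw [e1]
      simp only [smul_apply, ContinuousLinearMap.comp_apply]
      rw [map_smul, h2, map_smul, inv_smul_smul₀ hd, hφ']
  · exact (hc.comp_clm V).smul ((z - x)⁻¹)

/-- The spectral theorem for the compact symmetric `R` makes its eigenvectors total. Since `R` is
injective, their eigenvalues are nonzero, so they are eigenvectors of `T`. -/
theorem HasCompactResolvent.eq_zero_of_orthogonal {T : H →ₗ.[ℂ] H}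
    (hT : HasCompactResolvent T) {φ : H}
    (hφ : ∀ x : ℝ, ∀ ψ ∈ eigenspace T x, inner ℂ ψ φ = 0) : φ = 0 := by
  obtain ⟨x, R, hR, hc⟩ := hT.exists_resolvent
  have hsymm : R.IsSymmetric := hT.symm.resolvent_inner hR
  have key := ContinuousLinearMap.orthogonalComplement_iSup_eigenspaces_eq_bot hc hsymm
  have hmem : φ ∈ (⨆ ν, Module.End.eigenspace (R : Module.End ℂ H) ν)ᗮ := by
    rw [Submodule.mem_orthogonal]
    intro u hu
    induction hu using Submodule.iSup_induction' with
    | zero => exact inner_zero_left _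
    | add a b _ _ ha hb => rw [inner_add_left, ha, hb, add_zero]
    | mem ν v hv =>
      by_cases hv0 : v = 0
      · rw [hv0, inner_zero_left]
      rw [Module.End.mem_eigenspace_iff] at hv
      have hν : ν ≠ 0 := by
        rintro rfl
        rw [zero_smul] at hv
        have hv' : R v = 0 := hv
        rw [isResolventAt_iff_graph] at hR
        have h1 := hR.1 v
        rw [hv', smul_zero, add_zero] at h1
        exact hv0 (LinearPMap.graph_fst_eq_zero_snd T h1 rfl)
      have he := hR.mem_eigenspace_of_resolvent hν hv
      rw [← hT.symm.eigenvalue_real he hv0] at he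
      exact hφ _ _ he
  rw [key] at hmem
  exact hmem

theorem HasCompactResolvent.perturb [TopologicalSpace.SeparableSpace H] {T : H →ₗ.[ℂ] H}
    (hT : HasCompactResolvent T) (μ : H) (h : ℝ) : HasCompactResolvent (perturb T μ h) := by
  refine ⟨hT.symm.perturb μ h, ?_⟩
  -- The eigenvalues of both operators are countable in number, so some real `x` is an eigenvalue of
  -- neither.
  obtain ⟨x, hx⟩ := (Set.nonempty_compl (α := ℝ)).mpr fun hu => Set.not_countable_univ (α := ℝ)
    (hu ▸ (hT.symm.countable_eigenvalues.union (hT.symm.perturb μ h).countable_eigenvalues))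
  simp only [Set.mem_compl_iff, Set.mem_union, Set.mem_ofPred_eq, not_or, not_not] at hx
  obtain ⟨R, hR, hc⟩ := hT.exists_resolvent_of_eigenspace_eq_bot hx.1
  obtain ⟨R', hR'⟩ := resolvent_perturb hT.symm hR hc hx.2
  exact ⟨x, R', hR'⟩

end CompactResolvent

/-! ### Simple discrete spectrum implies compact resolvent -/

theorem isCompactOperator_of_range_le {H : Type*} [NormedAddCommGroup H]
    [InnerProductSpace ℂ H] {F : Submodule ℂ H} [FiniteDimensional ℂ F] {P : H →L[ℂ] H}
    (hP : ∀ v, P v ∈ F) : IsCompactOperator P :=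
  (isCompactOperator_of_locallyCompactSpace_rng F.subtypeL).comp_clm (P.codRestrict F hP)

theorem IsResolventAt.inv_mem_spec {H : Type*} [NormedAddCommGroup H]
    [InnerProductSpace ℂ H] {T : H →ₗ.[ℂ] H} {x : ℝ} {R : H →L[ℂ] H}
    (hR : IsResolventAt T x R) {ν : ℝ} (hν : ν ≠ 0) (hσ : ν ∈ spectrum ℝ R) :
    ((x + ν⁻¹ : ℝ) : ℂ) ∈ spec T := by
  rintro ⟨S, hS⟩
  have hν' : (ν : ℂ) ≠ 0 := by exact_mod_cast hν
  rw [isResolventAt_iff_graph] at hR hS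
  have hgr : ∀ ψ, R (S ψ) = (ν : ℂ) • (S ψ - R ψ) := by
    intro ψ
    have h1 := hR.2 _ _ (hS.1 ψ)
    have e : ψ + ((x + ν⁻¹ : ℝ) : ℂ) • S ψ - (x : ℂ) • S ψ = ψ + (ν : ℂ)⁻¹ • S ψ := by
      push_cast
      module
    rw [e, map_add, map_smul] at h1
    rw [← h1, add_sub_cancel_left, h1, smul_inv_smul₀ hν']
  have hgr' : ∀ ψ, S (R ψ) = (ν : ℂ) • (S ψ - R ψ) := by
    intro ψ
    have h1 := hS.2 _ _ (hR.1 ψ)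
    have e : ψ + (x : ℂ) • R ψ - ((x + ν⁻¹ : ℝ) : ℂ) • R ψ = ψ - (ν : ℂ)⁻¹ • R ψ := by
      push_cast
      module
    rw [e, map_sub, map_smul] at h1
    have : (ν : ℂ)⁻¹ • S (R ψ) = S ψ - R ψ := by linear_combination (norm := module) -h1
    rw [← this, smul_inv_smul₀ hν']
  apply hσ
  have halg : ∀ ψ : H, (algebraMap ℝ (H →L[ℂ] H) ν) ψ = (ν : ℂ) • ψ := by
    intro ψ
    rw [Algebra.algebraMap_eq_smul_one]
    simp
  have hi : (ν : ℂ) * (ν : ℂ)⁻¹ = 1 := mul_inv_cancel₀ hν'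
  -- If `S` is the resolvent at `x + ν⁻¹`, then `(ν - R)⁻¹ = ν⁻¹ + ν⁻² S`.
  refine ⟨⟨algebraMap ℝ (H →L[ℂ] H) ν - R,
    (ν : ℂ)⁻¹ • (1 : H →L[ℂ] H) + ((ν : ℂ)⁻¹ * (ν : ℂ)⁻¹) • S, ?_, ?_⟩, rfl⟩
  · ext ψ
    simp only [mul_apply_eq_comp, sub_apply, add_apply, smul_apply,
      one_apply_eq_self, halg, map_add, map_smul, hgr]
    match_scalars <;> field_simp <;> ring
  · ext ψ
    simp only [mul_apply_eq_comp, sub_apply, add_apply, smul_apply,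
      one_apply_eq_self, halg, map_sub, map_smul, hgr']
    match_scalars <;> field_simp <;> ring

section Discrete

variable {H : Type*} [NormedAddCommGroup H] [InnerProductSpace ℂ H] [CompleteSpace H]

theorem eventually_notMem_spectrum {T : H →ₗ.[ℂ] H} (hT : HasSimpleDiscreteSpectrum T) {x : ℝ}
    {R : H →L[ℂ] H} (hR : IsResolventAt T x R) {ν : ℝ} (hν : ν ≠ 0) :
    ∀ᶠ t in nhdsWithin ν {ν}ᶜ, t ∉ spectrum ℝ R := by
  by_cases hσ : ν ∈ spectrum ℝ R
  · have h1 := hT.isolated _ (hR.inv_mem_spec hν hσ)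
    have hc : Filter.Tendsto (fun t : ℝ => ((x + t⁻¹ : ℝ) : ℂ)) (nhdsWithin ν {ν}ᶜ)
        (nhdsWithin ((x + ν⁻¹ : ℝ) : ℂ) {((x + ν⁻¹ : ℝ) : ℂ)}ᶜ) := by
      refine tendsto_nhdsWithin_iff.mpr ⟨?_, ?_⟩
      · have : ContinuousAt (fun t : ℝ => ((x + t⁻¹ : ℝ) : ℂ)) ν :=
          Complex.continuous_ofReal.continuousAt.comp
            (continuousAt_const.add (continuousAt_inv₀ hν))
        exact this.mono_left nhdsWithin_le_nhds
      · filter_upwards [self_mem_nhdsWithin] with t ht h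
        apply ht
        have : x + t⁻¹ = x + ν⁻¹ := by exact_mod_cast Set.mem_singleton_iff.mp h
        exact inv_injective (add_left_cancel this)
    have h0 : ∀ᶠ t in nhdsWithin ν {ν}ᶜ, t ≠ 0 :=
      (eventually_ne_nhds hν).filter_mono nhdsWithin_le_nhds
    filter_upwards [hc.eventually h1, h0] with t ht ht0 hts
    exact ht (hR.inv_mem_spec ht0 hts)
  · exact Filter.Eventually.filter_mono nhdsWithin_le_nhds
      ((spectrum.isClosed R).isOpen_compl.mem_nhds hσ)

theorem finite_spectrum_ge {T : H →ₗ.[ℂ] H} (hT : HasSimpleDiscreteSpectrum T) {x : ℝ}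
    {R : H →L[ℂ] H} (hR : IsResolventAt T x R) {ε : ℝ} (hε : 0 < ε) :
    (spectrum ℝ R ∩ {t | ε ≤ |t|}).Finite := by
  have hcl : IsClosed {t : ℝ | ε ≤ |t|} := isClosed_le continuous_const continuous_abs
  by_contra hinf
  obtain ⟨ν, hν, hacc⟩ := Set.Infinite.exists_accPt_of_subset_isCompact hinf
    ((spectrum.isCompact R).inter_right hcl) subset_rfl
  have hν0 : ν ≠ 0 := by
    rintro rfl
    have := hν.2
    simp only [Set.mem_ofPred_eq, abs_zero] at this
    linarith
  rw [accPt_iff_frequently_nhdsNE] at hacc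
  exact hacc ((eventually_notMem_spectrum hT hR hν0).mono fun t ht h => ht h.1)

theorem continuousOn_indicator_singleton {T : H →ₗ.[ℂ] H} (hT : HasSimpleDiscreteSpectrum T)
    {x : ℝ} {R : H →L[ℂ] H} (hR : IsResolventAt T x R) {ν : ℝ} (hν : ν ≠ 0) :
    ContinuousOn (Set.indicator {ν} (fun _ => (1 : ℝ))) (spectrum ℝ R) := by
  intro t _
  by_cases htν : t = ν
  · subst htν
    refine ContinuousWithinAt.congr_of_eventuallyEq (f := fun _ => 1) continuousWithinAt_const ?_
      (by simp)
    have h1 := eventually_nhdsWithin_iff.mp (eventually_notMem_spectrum hT hR hν)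
    filter_upwards [h1.filter_mono nhdsWithin_le_nhds, self_mem_nhdsWithin] with s hs hsσ
    by_cases hst : s = t
    · simp [hst]
    · exact absurd hsσ (hs hst)
  · refine ContinuousWithinAt.congr_of_eventuallyEq (f := fun _ => 0) continuousWithinAt_const ?_
      (by simp [htν])
    filter_upwards [(eventually_ne_nhds htν).filter_mono nhdsWithin_le_nhds] with s hs
    simp [hs]

/-- As `ν` is isolated in the spectrum of `R`, the indicator is continuous there and yields the
spectral projection, whose range lies in a one-dimensional eigenspace of `T`. -/
theorem isCompactOperator_cfc_indicator {T : H →ₗ.[ℂ] H} (hT : HasSimpleDiscreteSpectrum T)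
    {x : ℝ} {R : H →L[ℂ] H} (hR : IsResolventAt T x R) (hsa : IsSelfAdjoint R) {ν : ℝ}
    (hν : ν ≠ 0) : 
    IsCompactOperator (cfc (Set.indicator {ν} (fun _ => (1 : ℝ))) R : H →L[ℂ] H) := by
  by_cases hσ : ν ∈ spectrum ℝ R
  · have hcont := continuousOn_indicator_singleton hT hR hν
    have : FiniteDimensional ℂ (eigenspace T ((x + ν⁻¹ : ℝ) : ℂ)) :=
      FiniteDimensional.of_finrank_pos
        (by rw [hT.simple _ (hR.inv_mem_spec hν hσ)]; exact one_pos)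
    have hmul : R * cfc (Set.indicator {ν} (fun _ => (1 : ℝ))) R =
        ν • cfc (Set.indicator {ν} (fun _ => (1 : ℝ))) R := by
      nth_rw 1 [← cfc_id' ℝ R]
      rw [← cfc_mul _ _ R (by fun_prop) hcont, ← cfc_const_mul _ _ R hcont]
      congr 1
      ext t
      by_cases h : t = ν
      · rw [h]
      · simp [h]
    refine isCompactOperator_of_range_le (F := eigenspace T ((x + ν⁻¹ : ℝ) : ℂ)) fun v => ?_
    have hv := congrArg (fun f : H →L[ℂ] H => f v) hmul
    push_cast
    refine hR.mem_eigenspace_of_resolvent (by exact_mod_cast hν) ?_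
    simpa using hv
  · have : cfc (Set.indicator {ν} (fun _ => (1 : ℝ))) R = cfc (fun _ => (0 : ℝ)) R := by
      refine cfc_congr fun t ht => ?_
      have : t ≠ ν := fun h => hσ (h ▸ ht)
      simp [this]
    rw [this, cfc_const_zero]
    exact isCompactOperator_zero

/-- Only finitely many spectral points satisfy `|t| ≥ ε / 2`. The sum of their spectral components
is compact and within `ε` of `R`, and compact operators are norm closed. -/
theorem isCompactOperator_resolvent {T : H →ₗ.[ℂ] H} (hT : HasSimpleDiscreteSpectrum T) {x : ℝ}
    {R : H →L[ℂ] H} (hR : IsResolventAt T x R) (hsa : IsSelfAdjoint R) :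
    IsCompactOperator R := by
  suffices h : R ∈ closure {f : H →L[ℂ] H | IsCompactOperator f} by
    rwa [(isClosed_setOfPred_isCompactOperator (σ₁₂ := RingHom.id ℂ) (M₁ := H)
      (M₂ := H)).closure_eq] at h
  rw [Metric.mem_closure_iff]
  intro ε hε
  have hfin := finite_spectrum_ge hT hR (half_pos hε)
  set s := hfin.toFinset with hs
  have hs0 : ∀ ν ∈ s, ν ≠ 0 := by
    intro ν hν h0
    rw [hs, Set.Finite.mem_toFinset] at hν
    have := hν.2
    simp only [Set.mem_ofPred_eq, h0, abs_zero] at this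
    linarith
  have hcont : ∀ ν ∈ s, ContinuousOn (fun t => ν * Set.indicator {ν} (fun _ => (1 : ℝ)) t)
      (spectrum ℝ R) := fun ν hν =>
    continuousOn_const.mul (continuousOn_indicator_singleton hT hR (hs0 ν hν))
  refine ⟨∑ ν ∈ s, cfc (fun t => ν * Set.indicator {ν} (fun _ => (1 : ℝ)) t) R, ?_, ?_⟩
  · refine (compactOperator (RingHom.id ℂ) H H).sum_mem fun ν hν => ?_
    rw [cfc_const_mul _ _ R (continuousOn_indicator_singleton hT hR (hs0 ν hν))]
    exact (isCompactOperator_cfc_indicator hT hR hsa (hs0 ν hν)).smul ν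
  · rw [dist_eq_norm, ← cfc_sum _ R s hcont]
    have hsum : ContinuousOn (∑ ν ∈ s, fun t => ν * Set.indicator {ν} (fun _ => (1 : ℝ)) t)
        (spectrum ℝ R) := by
      rw [show (∑ ν ∈ s, fun t => ν * Set.indicator {ν} (fun _ => (1 : ℝ)) t) =
        fun t => ∑ ν ∈ s, ν * Set.indicator {ν} (fun _ => (1 : ℝ)) t by ext; simp]
      exact continuousOn_finsetSum _ hcont
    nth_rw 1 [← cfc_id' ℝ R]
    rw [← cfc_sub _ _ R (by fun_prop) hsum]
    refine (norm_cfc_le (half_pos hε).le fun t ht => ?_).trans_lt (half_lt_self hε)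
    have hval : (∑ ν ∈ s, fun t => ν * Set.indicator {ν} (fun _ => (1 : ℝ)) t) t =
        if t ∈ s then t else 0 := by
      classical
      simp [Finset.sum_apply, Set.indicator_apply]
    rw [hval]
    split_ifs with hts
    · simp only [sub_self, norm_zero]
      exact (half_pos hε).le
    · rw [hs, Set.Finite.mem_toFinset] at hts
      have : ¬ ε / 2 ≤ |t| := fun h => hts ⟨ht, h⟩
      rw [sub_zero, Real.norm_eq_abs]
      exact (not_le.mp this).le

theorem HasSimpleDiscreteSpectrum.hasCompactResolvent [TopologicalSpace.SeparableSpace H]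
    {T : H →ₗ.[ℂ] H} (hT : HasSimpleDiscreteSpectrum T) (hsa : IsSelfAdjoint T) :
    HasCompactResolvent T := by
  have hsymm := isSymm_of_isSelfAdjoint hsa
  refine ⟨hsymm, ?_⟩
  obtain ⟨x, hx⟩ := (Set.nonempty_compl (α := ℝ)).mpr fun hu => Set.not_countable_univ (α := ℝ)
    (hu ▸ hsymm.countable_eigenvalues)
  simp only [Set.mem_compl_iff, Set.mem_ofPred_eq, not_not] at hx
  have hxs : (x : ℂ) ∉ spec T := by
    intro h
    have := hT.simple _ h
    rw [hx, finrank_bot] at this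
    exact zero_ne_one this
  have hR := isResolventAt_resolv hxs
  refine ⟨x, _, hR, isCompactOperator_resolvent hT hR ?_⟩
  rw [ContinuousLinearMap.isSelfAdjoint_iff_isSymmetric]
  exact hsymm.resolvent_inner hR

end Discrete

/-! ### Consequences of cyclicity -/

section Cyclic

variable {H : Type*} [NormedAddCommGroup H] [InnerProductSpace ℂ H]

theorem perturb_zero (A : H →ₗ.[ℂ] H) (μ : H) : perturb A μ 0 = A := by
  refine LinearPMap.eq_of_eq_graph ?_
  ext ⟨φ, χ⟩
  rw [mem_graph_perturb]
  simp

theorem inner_ne_zero_of_mem_eigenspace_perturb {A : H →ₗ.[ℂ] H} (hA : IsSymm A) {μ : H}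
    (hcyc : IsCyclicVector A μ) {h : ℝ} {z : ℂ} {e : H} (he : e ∈ eigenspace (perturb A μ h) z)
    (he0 : e ≠ 0) : inner ℂ μ e ≠ 0 := by
  -- With `⟨μ, e⟩ = 0` the perturbation does not act on `e`, so `e` is an eigenvector of `A`; it is
  -- then orthogonal to every `(A - w)⁻¹ μ`.
  intro h0
  have hz := (hA.perturb μ h).eigenvalue_real he he0
  rw [mem_eigenspace_iff_graph, mem_graph_perturb, h0, zero_smul, smul_zero, sub_zero] at he
  refine he0 (hcyc.eq_zero_of_inner_left ℂ fun v hv => ?_)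
  induction hv using Submodule.span_induction with
  | zero => exact inner_zero_right _
  | add a b _ _ ha hb => rw [inner_add_right, ha, hb, add_zero]
  | smul c a _ ha => rw [inner_smul_right, ha, mul_zero]
  | mem r hr =>
    obtain ⟨w, hw, rfl⟩ := hr
    have hR := isResolventAt_resolv hw
    have hbot := hR.eigenspace_eq_bot
    rw [isResolventAt_iff_graph] at hR
    have h1 := hA _ _ _ _ he (hR.1 μ)
    have hμe : inner ℂ e μ = 0 := inner_eq_zero_symm.mp h0
    rw [inner_smul_left, ← hz, Complex.conj_ofReal, hz, inner_add_right, inner_smul_right, hμe,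
      zero_add] at h1
    by_contra hne
    have hzw := mul_right_cancel₀ hne h1
    rw [← mem_eigenspace_iff_graph, hzw, hbot] at he
    exact he0 he

theorem eq_smul_of_mem_eigenspace_perturb {A : H →ₗ.[ℂ] H} (hA : IsSymm A) {μ : H}
    (hcyc : IsCyclicVector A μ) {h : ℝ} {z : ℂ} {e ψ : H} (he : e ∈ eigenspace (perturb A μ h) z)
    (he1 : inner ℂ μ e = 1) (hψ : ψ ∈ eigenspace (perturb A μ h) z) :
    ψ = inner ℂ μ ψ • e := by
  by_contra hne
  refine inner_ne_zero_of_mem_eigenspace_perturb hA hcyc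
    (Submodule.sub_mem _ hψ (Submodule.smul_mem _ (inner ℂ μ ψ) he)) (sub_ne_zero.mpr hne) ?_
  rw [inner_sub_right, inner_smul_right, he1, mul_one, sub_self]

theorem exists_normalized_eigenvector {A : H →ₗ.[ℂ] H} (hA : IsSymm A) {μ : H}
    (hcyc : IsCyclicVector A μ) {h : ℝ} {z : ℂ} (hz : eigenspace (perturb A μ h) z ≠ ⊥) :
    ∃ e ∈ eigenspace (perturb A μ h) z, inner ℂ μ e = 1 := by
  obtain ⟨v, hv, hv0⟩ := Submodule.exists_mem_ne_zero_of_ne_bot hz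
  refine ⟨(inner ℂ μ v)⁻¹ • v, Submodule.smul_mem _ _ hv, ?_⟩
  rw [inner_smul_right,
    inv_mul_cancel₀ (inner_ne_zero_of_mem_eigenspace_perturb hA hcyc hv hv0)]

/-- Shifting a simple eigenvalue `x` by a rank-one perturbation along its eigenvector removes `x`
from the point spectrum. -/
theorem eigenspace_perturb_eigenvector {T : H →ₗ.[ℂ] H} (hT : IsSymm T) {x : ℝ} {e : H}
    (he : e ∈ eigenspace T x) (he0 : e ≠ 0) (hs : ∀ ψ ∈ eigenspace T x, ∃ c : ℂ, ψ = c • e) :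
    eigenspace (perturb T e 1) x = ⊥ := by
  have hE : inner ℂ e e ≠ 0 := inner_self_ne_zero.mpr he0
  rw [eq_bot_iff]
  intro φ hφ
  rw [mem_eigenspace_iff_graph, mem_graph_perturb] at hφ
  rw [mem_eigenspace_iff_graph] at he
  have h1 := hT _ _ _ _ he hφ
  simp only [inner_smul_left, inner_sub_right, inner_smul_right, Complex.conj_ofReal] at h1
  have h2 : inner ℂ e φ * inner ℂ e e = 0 := by
    push_cast at h1
    linear_combination h1
  have h3 := (mul_eq_zero.mp h2).resolve_right hE
  rw [h3, zero_smul, smul_zero, sub_zero, ← mem_eigenspace_iff_graph] at hφ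
  obtain ⟨c, rfl⟩ := hs φ hφ
  rw [inner_smul_right] at h3
  rw [(mul_eq_zero.mp h3).resolve_right hE, zero_smul]
  exact Submodule.zero_mem _

end Cyclic

/-! ### The values of `ξ` at eigenvalues -/

section Xi

variable {H : Type*} [NormedAddCommGroup H] [InnerProductSpace ℂ H] [CompleteSpace H]
  [TopologicalSpace.SeparableSpace H]

/-- `S` serves as a reduced resolvent at the eigenvalue `x`: on `{e}ᗮ` it inverts `A_h - x`. -/
theorem exists_shifted_resolvent {A : H →ₗ.[ℂ] H} (hA : HasCompactResolvent A) {μ : H}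
    (hcyc : IsCyclicVector A μ) {h : ℝ} {x : ℝ} {e : H} (he : e ∈ eigenspace (perturb A μ h) x)
    (he1 : inner ℂ μ e = 1) : ∃ S, IsResolventAt (perturb (perturb A μ h) e 1) x S := by
  have he0 : e ≠ 0 := by
    rintro rfl
    simp at he1
  obtain ⟨S, hS, -⟩ := ((hA.perturb μ h).perturb e 1).exists_resolvent_of_eigenspace_eq_bot
    (eigenspace_perturb_eigenvector (hA.symm.perturb μ h) he he0
      fun ψ hψ => ⟨_, eq_smul_of_mem_eigenspace_perturb hA.symm hcyc he he1 hψ⟩)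
  exact ⟨S, hS⟩

open Filter Topology in
-- The component of `(A - w)⁻¹ μ` along `e` carries the pole `1 / (x - w)`, and the rest `v w` stays
-- bounded. So `(x - w) (A - w)⁻¹ μ` tends to `p = e / ‖e‖²` and `(x - w) F(w)` to `‖e‖⁻²`; the
-- quotient tends to `e`.
theorem tendsto_resolv_div_weyl {A : H →ₗ.[ℂ] H} (hA : HasCompactResolvent A)
    {μ : H} (hcyc : IsCyclicVector A μ) {x : ℝ}
    (hx : ∀ᶠ w in 𝓝[≠] (x : ℂ), w ∉ spec A) {e : H} (he : e ∈ eigenspace A x)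
    (he1 : inner ℂ μ e = 1) :
    Tendsto (fun w => (weyl A μ w)⁻¹ • resolv A w μ) (𝓝[≠] (x : ℂ)) (𝓝 e) := by
  have he' : e ∈ eigenspace (perturb A μ 0) x := by rwa [perturb_zero]
  obtain ⟨S, hS⟩ := exists_shifted_resolvent hA hcyc he' he1
  rw [perturb_zero, isResolventAt_iff_graph] at hS
  have he0 : e ≠ 0 := by
    rintro rfl
    simp at he1
  have hE : inner ℂ e e ≠ 0 := inner_self_ne_zero.mpr he0
  have hμe : inner ℂ e μ = 1 := by rw [← inner_conj_symm, he1, map_one]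
  rw [mem_eigenspace_iff_graph] at he
  set p : H := (inner ℂ e e)⁻¹ • e with hp
  have hep : inner ℂ e p = 1 := by rw [hp, inner_smul_right, inv_mul_cancel₀ hE]
  set v : ℂ → H := fun w => resolv A w μ - inner ℂ e (resolv A w μ) • p with hv
  have hpole : ∀ w ∉ spec A, (x - w) * inner ℂ e (resolv A w μ) = 1 := by
    intro w hw
    have hR := isResolventAt_resolv hw
    rw [isResolventAt_iff_graph] at hR
    have h1 := hA.symm _ _ _ _ he (hR.1 μ)
    rw [inner_smul_left, Complex.conj_ofReal, inner_add_right, inner_smul_right, hμe] at h1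
    linear_combination h1
  -- Since `v w` is orthogonal to `e`, the shift does not affect it and `S` applies. Near `x` the
  -- factor `w - x` makes this equation contractive, which bounds `v w`.
  have hfix : ∀ w ∉ spec A, S (μ - p) + (w - x) • S (v w) = v w := by
    intro w hw
    have hR := isResolventAt_resolv hw
    rw [isResolventAt_iff_graph] at hR
    have hev : inner ℂ e (v w) = 0 := by
      simp only [hv, inner_sub_right, inner_smul_right, hep, mul_one, sub_self]
    have hgr := A.graph.sub_mem (hR.1 μ)
      (A.graph.smul_mem (inner ℂ e (resolv A w μ)) (A.graph.smul_mem (inner ℂ e e)⁻¹ he))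
    have hmem : (v w, μ - p + w • v w) ∈ (perturb A e 1).graph := by
      rw [mem_graph_perturb, hev, zero_smul, smul_zero, sub_zero]
      convert hgr using 1
      refine Prod.ext rfl ?_
      simp only [Prod.smul_mk, Prod.mk_sub_mk]
      rw [smul_comm _ (x : ℂ) e, ← hp, smul_comm _ (x : ℂ) p, smul_smul (x : ℂ)]
      have h1 : (x : ℂ) * inner ℂ e (resolv A w μ) = 1 + w * inner ℂ e (resolv A w μ) := by
        linear_combination hpole w hw
      rw [h1, hv]
      module
    rw [← map_smul, ← map_add]
    convert hS.2 _ _ hmem using 2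
    module
  have hw0 : Tendsto (fun w : ℂ => (x : ℂ) - w) (𝓝[≠] (x : ℂ)) (𝓝 0) := by
    have : ContinuousAt (fun w : ℂ => (x : ℂ) - w) (x : ℂ) := by fun_prop
    have := this.tendsto
    rw [sub_self] at this
    exact this.mono_left nhdsWithin_le_nhds
  have hsmall : ∀ᶠ w in 𝓝[≠] (x : ℂ), ‖(x : ℂ) - w‖ * ‖S‖ < 1 / 2 := by
    have := (hw0.norm.mul_const ‖S‖)
    rw [norm_zero, zero_mul] at this
    exact this.eventually_lt_const (by norm_num)
  have hbdd : ∀ᶠ w in 𝓝[≠] (x : ℂ), ‖v w‖ ≤ 2 * ‖S (μ - p)‖ := by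
    filter_upwards [hx, hsmall] with w hw hs
    have h1 : ‖v w‖ ≤ ‖S (μ - p)‖ + ‖(w - x) • S (v w)‖ := by
      nth_rw 1 [← hfix w hw]
      exact norm_add_le _ _
    have h2 : ‖(w - x) • S (v w)‖ ≤ ‖(x : ℂ) - w‖ * ‖S‖ * ‖v w‖ := by
      rw [norm_smul, norm_sub_rev, mul_assoc]
      gcongr
      exact S.le_opNorm _
    have h3 : ‖(x : ℂ) - w‖ * ‖S‖ * ‖v w‖ ≤ 1 / 2 * ‖v w‖ := by gcongr
    linarith
  have hlim0 : Tendsto (fun w => ((x : ℂ) - w) • v w) (𝓝[≠] (x : ℂ)) (𝓝 0) := by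
    refine squeeze_zero_norm' (a := fun w => ‖(x : ℂ) - w‖ * (2 * ‖S (μ - p)‖)) ?_ ?_
    · filter_upwards [hbdd] with w hw
      rw [norm_smul]
      gcongr
    · have := (hw0.norm.mul_const (2 * ‖S (μ - p)‖))
      rwa [norm_zero, zero_mul] at this
  have hlim : Tendsto (fun w => ((x : ℂ) - w) • resolv A w μ) (𝓝[≠] (x : ℂ)) (𝓝 p) := by
    have := hlim0.add_const p
    rw [zero_add] at this
    refine this.congr' ?_
    filter_upwards [hx] with w hw
    rw [hv]
    simp only [smul_sub, smul_smul, hpole w hw, one_smul, sub_add_cancel]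
  have hμp : inner ℂ μ p = (inner ℂ e e)⁻¹ := by rw [hp, inner_smul_right, he1, mul_one]
  have hF : Tendsto (fun w => inner ℂ μ (((x : ℂ) - w) • resolv A w μ)) (𝓝[≠] (x : ℂ))
      (𝓝 (inner ℂ e e)⁻¹) := by
    rw [← hμp]
    exact tendsto_const_nhds.inner hlim
  have hall := (hF.inv₀ (inv_ne_zero hE)).smul hlim
  rw [inv_inv, hp, smul_inv_smul₀ hE] at hall
  refine hall.congr' ?_
  filter_upwards [hx, self_mem_nhdsWithin] with w hw hne
  have hd : (x : ℂ) - w ≠ 0 := sub_ne_zero.mpr (Ne.symm hne)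
  rw [inner_smul_right, smul_smul, mul_inv, mul_comm (_)⁻¹ (_)⁻¹, mul_assoc, inv_mul_cancel₀ hd,
    mul_one, weyl]

open Filter Topology in
theorem xi_eq_of_mem_eigenspace {A : H →ₗ.[ℂ] H} (hA : HasCompactResolvent A)
    (hdisc : HasSimpleDiscreteSpectrum A) {μ : H} (hcyc : IsCyclicVector A μ) {h x : ℝ} {e : H}
    (he : e ∈ eigenspace (perturb A μ h) x) (he1 : inner ℂ μ e = 1) : xi A μ x = e := by
  have hstar : star (x : ℂ) = x := Complex.conj_ofReal x
  unfold xi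
  rw [hstar]
  split_ifs with hx
  -- Pairing `(A - x) e = -h μ` with an eigenvector `e'` of `A` at `x`, normalized by `⟨μ, e'⟩ = 1`,
  -- gives `0 = -h`.
  · have hh : h = 0 := by
      have hne : eigenspace A (x : ℂ) ≠ ⊥ := by
        intro h0
        have := hdisc.simple _ hx
        rw [h0, finrank_bot] at this
        exact zero_ne_one this
      rw [← perturb_zero A μ] at hne
      obtain ⟨e', he', he1'⟩ := exists_normalized_eigenvector hA.symm hcyc hne
      rw [perturb_zero, mem_eigenspace_iff_graph] at he'
      rw [mem_eigenspace_iff_graph, mem_graph_perturb, he1, one_smul] at he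
      have h1 := hA.symm _ _ _ _ he' he
      have hμe : inner ℂ e' μ = 1 := by rw [← inner_conj_symm, he1', map_one]
      rw [inner_smul_left, Complex.conj_ofReal, inner_sub_right, inner_smul_right, inner_smul_right,
        hμe] at h1
      have : (h : ℂ) = 0 := by linear_combination h1
      exact_mod_cast this
    subst hh
    rw [perturb_zero] at he
    have ht := tendsto_resolv_div_weyl hA hcyc (hdisc.isolated _ hx) he he1
    have hs : Tendsto (star : ℂ → ℂ) (𝓝[≠] (x : ℂ)) (𝓝[≠] (x : ℂ)) := by
      refine tendsto_nhdsWithin_iff.mpr ⟨?_, ?_⟩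
      · have := (continuous_star (R := ℂ)).tendsto (x : ℂ)
        rw [hstar] at this
        exact this.mono_left nhdsWithin_le_nhds
      · filter_upwards [self_mem_nhdsWithin] with w hw hw'
        exact hw (star_injective (Eq.trans hw' hstar.symm))
    exact (ht.comp hs).limUnder_eq
  · have hR := isResolventAt_resolv hx
    rw [isResolventAt_iff_graph] at hR
    rw [mem_eigenspace_iff_graph, mem_graph_perturb, he1, one_smul] at he
    have h1 := hR.2 _ _ he
    rw [sub_sub_cancel_left, map_neg, map_smul] at h1
    have h2 : -(h : ℂ) * weyl A μ x = 1 := by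
      rw [← he1, ← h1, weyl, inner_neg_right, inner_smul_right]
      ring
    rw [← eq_inv_of_mul_eq_one_left h2, neg_smul]
    exact h1

end Xi

/-! ### Eigenvalues of `A_h` avoid `Sp(A_∞)` -/

section Infinity

variable {H : Type*} [NormedAddCommGroup H] [InnerProductSpace ℂ H]

theorem mem_graph_perturbInfty {A : H →ₗ.[ℂ] H} {μ : H} {φ χ : (ℂ ∙ μ)ᗮ} :
    (φ, χ) ∈ (perturbInfty A μ).graph ↔ ∃ c : ℂ, ((φ : H), (χ : H) + c • μ) ∈ A.graph := by
  rw [LinearPMap.mem_graph_iff]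
  constructor
  · rintro ⟨y, rfl, rfl⟩
    have h1 := (ℂ ∙ μ)ᗮ.sub_starProjection_mem_orthogonal (A ⟨((y : (ℂ ∙ μ)ᗮ) : H), y.2⟩)
    rw [Submodule.orthogonal_orthogonal, Submodule.mem_span_singleton] at h1
    obtain ⟨c, hc⟩ := h1
    refine ⟨c, ?_⟩
    rw [hc, perturbInfty_apply]
    convert A.mem_graph ⟨((y : (ℂ ∙ μ)ᗮ) : H), y.2⟩ using 2
    exact add_sub_cancel _ _
  · rintro ⟨c, hc⟩
    rw [LinearPMap.mem_graph_iff] at hc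
    obtain ⟨⟨y, hy⟩, h1, h2⟩ := hc
    simp only at h1 h2
    subst h1
    refine ⟨⟨φ, hy⟩, rfl, ?_⟩
    rw [perturbInfty_apply, h2, map_add, map_smul]
    have hμ : (ℂ ∙ μ)ᗮ.orthogonalProjectionOnto μ = 0 :=
      Submodule.orthogonalProjectionOnto_orthogonal_apply_eq_zero
        (Submodule.mem_span_singleton_self μ)
    rw [hμ, smul_zero, add_zero, Submodule.orthogonalProjectionOnto_mem_subspace_eq_self]

variable [CompleteSpace H] [TopologicalSpace.SeparableSpace H]

/-- For `ψ ⊥ μ` one solves `(A_h - x) φ = ψ + c μ` with `φ ⊥ μ`. Solvability forces the right side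
to be orthogonal to `e`, so `c = -⟨e, ψ⟩`; then `S` gives a solution, and subtracting a multiple of
`e` makes it orthogonal to `μ`. The operator `L` below does this. -/
theorem notMem_spec_perturbInfty {A : H →ₗ.[ℂ] H} (hA : HasCompactResolvent A)
    {μ : H} (hcyc : IsCyclicVector A μ) {h x : ℝ} {e : H}
    (he : e ∈ eigenspace (perturb A μ h) x) (he1 : inner ℂ μ e = 1) :
    (x : ℂ) ∉ spec (perturbInfty A μ) := by
  obtain ⟨S, hS⟩ := exists_shifted_resolvent hA hcyc he he1
  have hsymm := hA.symm.perturb μ h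
  have huniq : ∀ ψ ∈ eigenspace (perturb A μ h) (x : ℂ), ψ = inner ℂ μ ψ • e := fun ψ hψ =>
    eq_smul_of_mem_eigenspace_perturb hA.symm hcyc he he1 hψ
  have he0 : e ≠ 0 := by
    rintro rfl
    simp at he1
  have hE : inner ℂ e e ≠ 0 := inner_self_ne_zero.mpr he0
  have hμe : inner ℂ e μ = 1 := by rw [← inner_conj_symm, he1, map_one]
  rw [isResolventAt_iff_graph] at hS
  rw [mem_eigenspace_iff_graph] at he
  have hSgraph : ∀ v, inner ℂ e v = 0 → (S v, v + (x : ℂ) • S v) ∈ (perturb A μ h).graph := by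
    intro v hv
    have h1 := hS.1 v
    rw [mem_graph_perturb] at h1
    have h2 := hsymm _ _ _ _ he h1
    simp only [inner_smul_left, inner_sub_right, inner_add_right, inner_smul_right,
      Complex.conj_ofReal, hv] at h2
    have h3 : inner ℂ e (S v) * inner ℂ e e = 0 := by
      push_cast at h2
      linear_combination h2
    rwa [(mul_eq_zero.mp h3).resolve_right hE, zero_smul, smul_zero, sub_zero] at h1
  have hmem : ∀ φ : (ℂ ∙ μ)ᗮ, inner ℂ μ (φ : H) = 0 := fun φ =>
    Submodule.mem_orthogonal_singleton_iff_inner_right.mp φ.2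
  set L : H →L[ℂ] H := (ContinuousLinearMap.id ℂ H - (innerSL ℂ μ).smulRight e) ∘L S ∘L
    (ContinuousLinearMap.id ℂ H - (innerSL ℂ e).smulRight μ) with hL
  have hLapply : ∀ ψ, L ψ = S (ψ - inner ℂ e ψ • μ) - inner ℂ μ (S (ψ - inner ℂ e ψ • μ)) • e := by
    intro ψ
    simp [hL]
    module
  have hLmem : ∀ ψ, inner ℂ μ (L ψ) = 0 := by
    intro ψ
    rw [hLapply, inner_sub_right, inner_smul_right, he1, mul_one, sub_self]
  have hLgraph : ∀ ψ, (L ψ, ψ - inner ℂ e ψ • μ + (x : ℂ) • L ψ) ∈ (perturb A μ h).graph := by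
    intro ψ
    have h1 := hSgraph (ψ - inner ℂ e ψ • μ)
      (by rw [inner_sub_right, inner_smul_right, hμe, mul_one, sub_self])
    convert (perturb A μ h).graph.sub_mem h1 ((perturb A μ h).graph.smul_mem
      (inner ℂ μ (S (ψ - inner ℂ e ψ • μ))) he) using 1
    refine Prod.ext (hLapply ψ) ?_
    simp only [Prod.smul_mk, Prod.mk_sub_mk]
    rw [hLapply]
    module
  refine IsResolventAt.notMem_spec
    (R := (L ∘L (ℂ ∙ μ)ᗮ.subtypeL).codRestrict (ℂ ∙ μ)ᗮ fun ψ =>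
      Submodule.mem_orthogonal_singleton_iff_inner_right.mpr (hLmem ψ)) ?_
  rw [isResolventAt_iff_graph]
  constructor
  · intro ψ
    rw [mem_graph_perturbInfty]
    refine ⟨-inner ℂ e (ψ : H), ?_⟩
    have h1 := hLgraph ψ
    rw [mem_graph_perturb, hLmem, zero_smul, smul_zero, sub_zero] at h1
    convert h1 using 1
    refine Prod.ext rfl ?_
    change (ψ : H) + (x : ℂ) • L ψ + _ = _
    module
  · intro φ χ hφ
    rw [mem_graph_perturbInfty] at hφ
    obtain ⟨c, hc⟩ := hφ
    have hc' : ((φ : H), (χ : H) + c • μ) ∈ (perturb A μ h).graph := by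
      rwa [mem_graph_perturb, hmem, zero_smul, smul_zero, sub_zero]
    apply Subtype.ext
    set ψ : H := (χ : H) - (x : ℂ) • (φ : H) with hψ
    change L ψ = φ
    set d : H := φ - L ψ with hd
    -- Uniqueness: pairing with `e` kills the `μ` term, so `d` lies in the eigenspace; being
    -- orthogonal to `μ`, it vanishes.
    have hgr : (d, (x : ℂ) • d + (c + inner ℂ e ψ) • μ) ∈ (perturb A μ h).graph := by
      convert (perturb A μ h).graph.sub_mem hc' (hLgraph ψ) using 1
      refine Prod.ext rfl ?_
      simp only [Prod.mk_sub_mk]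
      have : (χ : H) = ψ + (x : ℂ) • (φ : H) := by rw [hψ, sub_add_cancel]
      rw [this, hd]
      module
    have h1 := hsymm _ _ _ _ he hgr
    rw [inner_smul_left, Complex.conj_ofReal, inner_add_right, inner_smul_right, inner_smul_right,
      hμe] at h1
    have h2 : c + inner ℂ e ψ = 0 := by linear_combination -h1
    rw [h2, zero_smul, add_zero, ← mem_eigenspace_iff_graph] at hgr
    have h3 := huniq d hgr
    rw [hd, inner_sub_right, hmem, hLmem, sub_zero, zero_smul] at h3
    exact (sub_eq_zero.mp h3).symm

end Infinity

open MeasureTheory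

/-! ### `L²` of an atomic measure -/

section Atomic

variable {H : Type*} [NormedAddCommGroup H]

/-- The purely atomic measure with mass `‖ξ x‖⁻²` at the points `x` satisfying `p`. -/
noncomputable def atomicMeasure (p : ℝ → Prop) (ξ : ℝ → H) : Measure ℝ :=
  Measure.sum fun x : {x : ℝ // p x} =>
    ENNReal.ofReal (‖ξ x‖ ^ 2)⁻¹ • Measure.dirac (x : ℝ)

variable {p : ℝ → Prop} {ξ : ℝ → H}

theorem ae_atomicMeasure_iff [Countable {x : ℝ // p x}] (hξ : ∀ x, p x → ξ x ≠ 0) {P : ℝ → Prop} :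
    (∀ᵐ x ∂atomicMeasure p ξ, P x) ↔ ∀ x, p x → P x := by
  rw [atomicMeasure, Measure.ae_sum_iff]
  refine (forall_congr' (q := fun x : {x : ℝ // p x} => P x) fun x => ?_).trans Subtype.forall
  have hpos : ENNReal.ofReal (‖ξ x‖ ^ 2)⁻¹ ≠ 0 := by
    have := norm_pos_iff.mpr (hξ x x.2)
    rw [Ne, ENNReal.ofReal_eq_zero, not_le]
    positivity
  rw [Measure.ae_ennreal_smul_measure_iff hpos, ae_dirac_eq, Filter.eventually_pure]

theorem lintegral_atomicMeasure (f : ℝ → ENNReal) :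
    ∫⁻ x, f x ∂atomicMeasure p ξ =
      ∑' x : {x : ℝ // p x}, ENNReal.ofReal (‖ξ x‖ ^ 2)⁻¹ * f x := by
  simp only [atomicMeasure, lintegral_sum_measure, lintegral_smul_measure, lintegral_dirac,
    smul_eq_mul]

theorem eLpNorm_atomicMeasure (f : ℝ → ℂ) :
    eLpNorm f 2 (atomicMeasure p ξ) =
      (∑' x : {x : ℝ // p x}, ENNReal.ofReal (‖(‖ξ x‖⁻¹ : ℝ) * f x‖ ^ 2)) ^ (1 / 2 : ℝ) := by
  rw [eLpNorm_eq_lintegral_rpow_enorm_toReal two_ne_zero ENNReal.ofNat_ne_top,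
    lintegral_atomicMeasure]
  congr 2
  ext x
  rw [norm_mul, mul_pow, ENNReal.ofReal_mul (by positivity), Complex.norm_real, norm_inv, norm_norm,
    inv_pow, ENNReal.toReal_ofNat, ENNReal.rpow_ofNat, ← ofReal_norm,
    ENNReal.ofReal_pow (norm_nonneg _)]

/-- Arbitrary `f` is allowed: it agrees almost everywhere with its restriction to the countable set
of atoms. -/
theorem aestronglyMeasurable_atomicMeasure [Countable {x : ℝ // p x}] (hξ : ∀ x, p x → ξ x ≠ 0)
    (f : ℝ → ℂ) : AEStronglyMeasurable f (atomicMeasure p ξ) := by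
  have hm : Measurable (Set.indicator {x | p x} f) := by
    refine measurable_zero.measurable_of_countable_ne ?_
    refine Set.Countable.mono (fun x hx => ?_) (Set.countable_coe_iff.mp ‹_› : {x | p x}.Countable)
    by_contra h
    exact hx (Set.indicator_of_notMem h f).symm
  refine hm.aestronglyMeasurable.congr ((ae_atomicMeasure_iff hξ).mpr fun x hx => ?_)
  exact Set.indicator_of_mem (s := {x | p x}) hx f

variable [InnerProductSpace ℂ H]

theorem hasSum_norm_inner_sq {ι : Type*} (b : HilbertBasis ι ℂ H) (φ : H) :
    HasSum (fun i => ‖inner ℂ (b i) φ‖ ^ 2) (‖φ‖ ^ 2) := by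
  have h := Complex.hasSum_re (b.hasSum_inner_mul_inner φ φ)
  have e : ∀ i, (inner ℂ φ (b i) * inner ℂ (b i) φ).re = ‖inner ℂ (b i) φ‖ ^ 2 := by
    intro i
    rw [← inner_conj_symm, Complex.conj_mul']
    norm_cast
  simp only [e] at h
  convert h using 1
  rw [inner_self_eq_norm_sq_to_K]
  norm_cast

theorem tsum_ofReal_norm_inner_sq {ι : Type*} (b : HilbertBasis ι ℂ H) (φ : H) :
    ∑' i, ENNReal.ofReal (‖inner ℂ (b i) φ‖ ^ 2) = ENNReal.ofReal (‖φ‖ ^ 2) := by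
  rw [← (hasSum_norm_inner_sq b φ).tsum_eq,
    ENNReal.ofReal_tsum_of_nonneg (fun _ => by positivity) (hasSum_norm_inner_sq b φ).summable]

theorem exists_linearIsometryEquiv_atomicMeasure [CompleteSpace H] [Countable {x : ℝ // p x}]
    (hξ : ∀ x, p x → ξ x ≠ 0) (b : HilbertBasis {x : ℝ // p x} ℂ H)
    (hb : ∀ x, b x = ((‖ξ x‖⁻¹ : ℝ) : ℂ) • ξ x) :
    ∃ U : H ≃ₗᵢ[ℂ] Lp ℂ 2 (atomicMeasure p ξ),
      ∀ φ : H, ∀ x, p x → U φ x = inner ℂ (ξ x) φ := by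
  have hcoef : ∀ (φ : H) (x : {x : ℝ // p x}),
      ((‖ξ x‖⁻¹ : ℝ) : ℂ) * inner ℂ (ξ x) φ = inner ℂ (b x) φ := by
    intro φ x
    rw [hb, inner_smul_left, Complex.conj_ofReal]
  have hnorm : ∀ φ : H, eLpNorm (fun x => inner ℂ (ξ x) φ) 2 (atomicMeasure p ξ) = ‖φ‖ₑ := by
    intro φ
    simp only [eLpNorm_atomicMeasure, hcoef]
    rw [tsum_ofReal_norm_inner_sq, ENNReal.ofReal_pow (norm_nonneg _), ofReal_norm,
      ← ENNReal.rpow_natCast, ← ENNReal.rpow_mul]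
    norm_num
  have hmem : ∀ φ : H, MemLp (fun x => inner ℂ (ξ x) φ) 2 (atomicMeasure p ξ) := fun φ =>
    ⟨aestronglyMeasurable_atomicMeasure hξ _, by rw [hnorm]; exact enorm_lt_top⟩
  let V : H →ₗᵢ[ℂ] Lp ℂ 2 (atomicMeasure p ξ) :=
    { toFun := fun φ => (hmem φ).toLp
      map_add' := fun φ ψ => by
        rw [← MemLp.toLp_add]
        congr 1
        ext x
        exact inner_add_right _ _ _
      map_smul' := fun c φ => by
        rw [RingHom.id_apply, ← MemLp.toLp_const_smul]
        congr 1
        ext x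
        exact inner_smul_right _ _ _
      norm_map' := fun φ => by
        change ‖(hmem φ).toLp‖ = ‖φ‖
        rw [Lp.norm_toLp, hnorm, toReal_enorm] }
  have hV : ∀ φ x, p x → V φ x = inner ℂ (ξ x) φ := fun φ =>
    (ae_atomicMeasure_iff hξ).mp (hmem φ).coeFn_toLp
  have hsurj : Function.Surjective V := by
    intro f
    have hlt := (Lp.memLp f).2
    rw [eLpNorm_atomicMeasure, ENNReal.rpow_lt_top_iff_of_pos (by norm_num)] at hlt
    -- The prescribed basis coefficients: `f` has finite `L²` norm exactly when these are square
    -- summable.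
    have hc : Memℓp (fun x : {x : ℝ // p x} => ((‖ξ x‖⁻¹ : ℝ) : ℂ) * f x) 2 := by
      refine memℓp_gen ?_
      simp only [ENNReal.toReal_ofNat, Real.rpow_ofNat]
      have := ENNReal.summable_toReal hlt.ne
      simpa only [ENNReal.toReal_ofReal (sq_nonneg _)] using this
    refine ⟨b.repr.symm ⟨_, hc⟩, Lp.ext ?_⟩
    refine (ae_atomicMeasure_iff hξ).mpr fun x hx => ?_
    rw [hV _ x hx]
    have h1 := hcoef (b.repr.symm ⟨_, hc⟩) ⟨x, hx⟩
    rw [← b.repr_apply_apply, LinearIsometryEquiv.apply_symm_apply] at h1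
    have h2 : ((‖ξ x‖⁻¹ : ℝ) : ℂ) ≠ 0 := by
      exact_mod_cast inv_ne_zero (norm_ne_zero_iff.mpr (hξ x hx))
    exact mul_left_cancel₀ h2 h1
  exact ⟨LinearIsometryEquiv.ofSurjective V hsurj, hV⟩

end Atomic

/-! ### The spectral measure in an eigenbasis -/

section SpectralMeasure

variable {H : Type*} [NormedAddCommGroup H] [InnerProductSpace ℂ H]

theorem IsSymm.inner_eq_zero_of_mem_spectralSubspace {T : H →ₗ.[ℂ] H} (hT : IsSymm T) {x t : ℝ}
    (hxt : t < x) {e ψ : H} (he : e ∈ eigenspace T x) (hψ : ψ ∈ spectralSubspace T t) :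
    inner ℂ e ψ = 0 := by
  rw [← Submodule.mem_orthogonal_singleton_iff_inner_right]
  refine Submodule.topologicalClosure_minimal _ (iSup_le fun y v hv => ?_)
    (Submodule.isClosed_orthogonal _) hψ
  exact Submodule.mem_orthogonal_singleton_iff_inner_right.mpr
    (hT.inner_eq_zero (y.2.trans_lt hxt).ne' he hv)

variable [CompleteSpace H]

theorem spectralFunction_eq_norm_sq (T : H →ₗ.[ℂ] H) (μ : H) (t : ℝ) :
    spectralFunction T μ t = ‖(spectralSubspace T t).starProjection μ‖ ^ 2 := by
  have h := Submodule.inner_starProjection_left_eq_right (spectralSubspace T t) μ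
    ((spectralSubspace T t).starProjection μ)
  rw [Submodule.starProjection_eq_self_iff.mpr (Submodule.starProjection_apply_mem _ _)] at h
  unfold spectralFunction spectralResolution
  rw [← h, inner_self_eq_norm_sq_to_K]
  norm_cast

theorem IsSymm.inner_starProjection_spectralSubspace {T : H →ₗ.[ℂ] H} (hT : IsSymm T) {x t : ℝ}
    {e : H} (he : e ∈ eigenspace T x) (μ : H) :
    inner ℂ e ((spectralSubspace T t).starProjection μ) = if x ≤ t then inner ℂ e μ else 0 := by
  split_ifs with hxt
  · rw [← Submodule.inner_starProjection_left_eq_right, Submodule.starProjection_eq_self_iff.mpr]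
    exact Submodule.le_topologicalClosure _
      (Submodule.mem_iSup_of_mem (p := fun y : Set.Iic t => eigenspace T ((y : ℝ) : ℂ))
        ⟨x, hxt⟩ he)
  · exact hT.inner_eq_zero_of_mem_spectralSubspace (not_le.mp hxt) he
      (Submodule.starProjection_apply_mem _ _)

/-- By Parseval `‖E(t) μ‖²` is the sum of the weights at atoms `x ≤ t`, i.e. the distribution
function of the atomic measure, which has mass `‖μ‖² = 1`. Right continuity of the spectral function
comes for free. -/
theorem IsSymm.spectralMeasure_eq_atomicMeasure {T : H →ₗ.[ℂ] H} (hT : IsSymm T) {μ : H}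
    (hμ : ‖μ‖ = 1) {p : ℝ → Prop} {ξ : ℝ → H} (b : HilbertBasis {x : ℝ // p x} ℂ H)
    (hb : ∀ x : {x : ℝ // p x}, b x ∈ eigenspace T ((x : ℝ) : ℂ))
    (hw : ∀ x : {x : ℝ // p x}, ‖inner ℂ (b x) μ‖ ^ 2 = (‖ξ x‖ ^ 2)⁻¹) :
    spectralMeasure T μ = atomicMeasure p ξ := by
  have hsum : HasSum (fun x : {x : ℝ // p x} => (‖ξ x‖ ^ 2)⁻¹) 1 := by
    have := hasSum_norm_inner_sq b μ
    simpa only [hw, hμ, one_pow] using this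
  have hprob : IsProbabilityMeasure (atomicMeasure p ξ) :=
    hsum.isProbabilityMeasure_sum_dirac fun _ => by positivity
  have hcdf : spectralFunction T μ = ProbabilityTheory.cdf (atomicMeasure p ξ) := by
    ext t
    rw [ProbabilityTheory.cdf_eq_real, measureReal_def, ← lintegral_indicator_one measurableSet_Iic,
      lintegral_atomicMeasure, spectralFunction_eq_norm_sq]
    have : ∀ x : {x : ℝ // p x}, ENNReal.ofReal (‖ξ x‖ ^ 2)⁻¹ * (Set.Iic t).indicator 1 (x : ℝ) =
        ENNReal.ofReal (‖inner ℂ (b x) ((spectralSubspace T t).starProjection μ)‖ ^ 2) := by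
      intro x
      rw [hT.inner_starProjection_spectralSubspace (hb x), ← hw]
      by_cases hxt : (x : ℝ) ≤ t
      · simp [hxt]
      · simp [hxt]
    simp only [this]
    rw [tsum_ofReal_norm_inner_sq, ENNReal.toReal_ofReal (sq_nonneg _)]
  have hst : (spectralFunction_mono T μ).stieltjesFunction =
      ProbabilityTheory.cdf (atomicMeasure p ξ) := by
    ext t
    rw [Monotone.stieltjesFunction_eq, hcdf, StieltjesFunction.rightLim_eq]
  rw [spectralMeasure, hst, ProbabilityTheory.measure_cdf]

theorem HasCompactResolvent.exists_hilbertBasis {T : H →ₗ.[ℂ] H} (hT : HasCompactResolvent T)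
    {p : ℝ → Prop} {v : ℝ → H} (hv : ∀ x, p x → v x ∈ eigenspace T x)
    (hn : ∀ x, p x → ‖v x‖ = 1)
    (hspan : ∀ x : ℝ, ∀ ψ ∈ eigenspace T x, ψ ≠ 0 → p x ∧ ∃ c : ℂ, ψ = c • v x) :
    ∃ b : HilbertBasis {x : ℝ // p x} ℂ H, ∀ x, b x = v x := by
  have ho : Orthonormal ℂ fun x : {x : ℝ // p x} => v x :=
    ⟨fun x => hn x x.2, fun x y hxy =>
      hT.symm.inner_eq_zero (fun h => hxy (Subtype.ext h)) (hv x x.2) (hv y y.2)⟩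
  have hbot : (Submodule.span ℂ (Set.range fun x : {x : ℝ // p x} => v x))ᗮ = ⊥ := by
    rw [eq_bot_iff]
    intro φ hφ
    rw [Submodule.mem_orthogonal] at hφ
    refine hT.eq_zero_of_orthogonal fun x ψ hψ => ?_
    by_cases h0 : ψ = 0
    · rw [h0, inner_zero_left]
    obtain ⟨hx, c, rfl⟩ := hspan x ψ hψ h0
    rw [inner_smul_left, hφ _ (Submodule.subset_span ⟨⟨x, hx⟩, rfl⟩), mul_zero]
  exact ⟨HilbertBasis.mkOfOrthogonalEqBot ho hbot,
    fun x => congrFun (HilbertBasis.coe_mkOfOrthogonalEqBot ho hbot) x⟩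

end SpectralMeasure

end RankOne

/-! ### The main theorem -/

open MeasureTheory in
theorem RankOne.spectralMeasure_perturb_and_unitary {H : Type*} [NormedAddCommGroup H]
    [InnerProductSpace ℂ H] [CompleteSpace H]
    [TopologicalSpace.SeparableSpace H] (A : H →ₗ.[ℂ] H) (hA : IsSelfAdjoint A)
    (hdisc : HasSimpleDiscreteSpectrum A) (μ : H) (hμ : ‖μ‖ = 1)
    (hcyc : IsCyclicVector A μ) (h : ℝ) :
    spectralMeasure (perturb A μ h) μ =
        atomicMeasure (fun x : ℝ => (x : ℂ) ∈ spec (perturb A μ h)) (fun x : ℝ => xi A μ x) ∧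
      ∃ U : H ≃ₗᵢ[ℂ] Lp ℂ 2 (spectralMeasure (perturb A μ h) μ),
        ∀ φ : H, ∀ᵐ x : ℝ ∂(spectralMeasure (perturb A μ h) μ),
          ∃ hx : (x : ℂ) ∉ spec (perturbInfty A μ), U φ x = Phi A μ φ ⟨(x : ℂ), hx⟩ := by
  have hAc := hdisc.hasCompactResolvent hA
  have hTc := hAc.perturb μ h
  set p : ℝ → Prop := fun x => (x : ℂ) ∈ spec (perturb A μ h)
  set ξ : ℝ → H := fun x => xi A μ x
  have heig : ∀ x : ℝ, p x → eigenspace (perturb A μ h) x ≠ ⊥ := by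
    intro x hx h0
    obtain ⟨R, hR, -⟩ := hTc.exists_resolvent_of_eigenspace_eq_bot h0
    exact hR.notMem_spec hx
  have hspec : ∀ x : ℝ, ∀ ψ ∈ eigenspace (perturb A μ h) x, ψ ≠ 0 → p x := by
    rintro x ψ hψ h0 ⟨R, hR⟩
    rw [hR.eigenspace_eq_bot] at hψ
    exact h0 hψ
  have hxi : ∀ x : ℝ, p x → ξ x ∈ eigenspace (perturb A μ h) x ∧ inner ℂ μ (ξ x) = 1 := by
    intro x hx
    obtain ⟨e, he, he1⟩ := exists_normalized_eigenvector hAc.symm hcyc (heig x hx)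
    change xi A μ x ∈ _ ∧ inner ℂ μ (xi A μ x) = 1
    rw [xi_eq_of_mem_eigenspace hAc hdisc hcyc he he1]
    exact ⟨he, he1⟩
  have hne : ∀ x, p x → ξ x ≠ 0 := by
    intro x hx h0
    have := (hxi x hx).2
    rw [h0, inner_zero_right] at this
    exact zero_ne_one this
  have hcount : Countable {x : ℝ // p x} :=
    (hTc.symm.countable_eigenvalues.mono heig).to_subtype
  obtain ⟨b, hb⟩ := hTc.exists_hilbertBasis (p := p) (v := fun x => ((‖ξ x‖⁻¹ : ℝ) : ℂ) • ξ x)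
    (fun x hx => Submodule.smul_mem _ _ (hxi x hx).1)
    (fun x hx => by
      rw [norm_smul, Complex.norm_real, norm_inv, norm_norm,
        inv_mul_cancel₀ (norm_ne_zero_iff.mpr (hne x hx))])
    (fun x ψ hψ h0 => by
      have hx := hspec x ψ hψ h0
      refine ⟨hx, inner ℂ μ ψ * ‖ξ x‖, ?_⟩
      have h1 : (‖ξ x‖ : ℂ) ≠ 0 := by exact_mod_cast norm_ne_zero_iff.mpr (hne x hx)
      rw [smul_smul, Complex.ofReal_inv, mul_assoc, mul_inv_cancel₀ h1, mul_one]
      exact eq_smul_of_mem_eigenspace_perturb hAc.symm hcyc (hxi x hx).1 (hxi x hx).2 hψ)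
  have hmeas : spectralMeasure (perturb A μ h) μ = atomicMeasure p ξ := by
    refine hTc.symm.spectralMeasure_eq_atomicMeasure hμ b (fun x => ?_) (fun x => ?_)
    · rw [hb]
      exact Submodule.smul_mem _ _ (hxi x x.2).1
    · rw [hb, inner_smul_left, norm_mul, ← inner_conj_symm, (hxi x x.2).2]
      simp
  refine ⟨hmeas, ?_⟩
  rw [hmeas]
  obtain ⟨U, hU⟩ := exists_linearIsometryEquiv_atomicMeasure hne b hb
  refine ⟨U, fun φ => (ae_atomicMeasure_iff hne).mpr fun x hx => ⟨?_, hU φ x hx⟩⟩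
  exact notMem_spec_perturbInfty hAc hcyc (hxi x hx).1 (hxi x hx).2

theorem proposition3 {H : Type*} [NormedAddCommGroup H] [InnerProductSpace ℂ H] [CompleteSpace H]
    [TopologicalSpace.SeparableSpace H] (A : H →ₗ.[ℂ] H) (hA : IsSelfAdjoint A)
    (hdisc : RankOne.HasSimpleDiscreteSpectrum A) (μ : H) (hμ : ‖μ‖ = 1)
    (hcyc : RankOne.IsCyclicVector A μ) (h : ℝ) :
    RankOne.spectralMeasure (RankOne.perturb A μ h) μ =
        MeasureTheory.Measure.sum
          (fun x : {x : ℝ // (x : ℂ) ∈ RankOne.spec (RankOne.perturb A μ h)} =>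
            ENNReal.ofReal (‖RankOne.xi A μ ((x : ℝ) : ℂ)‖ ^ 2)⁻¹ •
              MeasureTheory.Measure.dirac (x : ℝ)) ∧
      ∃ U : H ≃ₗᵢ[ℂ] MeasureTheory.Lp ℂ 2 (RankOne.spectralMeasure (RankOne.perturb A μ h) μ),
        ∀ φ : H, ∀ᵐ x : ℝ ∂(RankOne.spectralMeasure (RankOne.perturb A μ h) μ),
          ∃ hx : (x : ℂ) ∉ RankOne.spec (RankOne.perturbInfty A μ),
            U φ x = RankOne.Phi A μ φ ⟨(x : ℂ), hx⟩ :=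
  RankOne.spectralMeasure_perturb_and_unitary A hA hdisc μ hμ hcyc h
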